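/- Let $\theta>0$ and $\beta>1$, and let $X_1,X_2,\dots$ be independent real random variables on a probability space, all with the Pseudo-Lindley distribution with parameters $(\theta,\beta)$, that is, with density $$f(x)=\frac{\theta(\beta-1+\theta x)e^{-\theta x}}{\beta}\,1_{\{x\ge 0\}}.$$ Let $X_{1,n}\le\dots\le X_{n,n}$ be the order statistics of $X_1,\dots,X_n$, and put $\gamma=1/\theta$. Let $k(n)$, $n\ge 1$, be integers with $0<k(n)\le n$ such that, as $n\to\infty$, $k(n)\to\infty$ and $k(n)^{3/4}/\log n\to 0$. Then the Hill estimator $$H_n=\frac1{k(n)}\sum_{j=1}^{k(n)} j\,\bigl(X_{n-j+1,n}-X_{n-j,n}\bigr)$$ satisfies, as $n\to\infty$, $$\sqrt{k(n)}\,(H_n-\gamma)\rightsquigarrow\mathcal N(0,\gamma^2),$$ where $\rightsquigarrow$ denotes convergence in distribution and $X_{0,n}:=0$ (this convention concerns only finitely many $n$, since $k(n)<n$ for all large $n$). -/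

import Mathlib

open MeasureTheory ProbabilityTheory Filter Set
open scoped Topology

namespace PseudoLindley

noncomputable section

/-- The density `θ (β - 1 + θ x) e^{-θ x} / β` on `x ≥ 0` of the Pseudo-Lindley distribution. -/
def pdf (θ β x : ℝ) : ℝ :=
  if 0 ≤ x then θ * (β - 1 + θ * x) * Real.exp (-(θ * x)) / β else 0

/-- The Pseudo-Lindley distribution with parameters `θ > 0` and `β > 1`, as a measure on `ℝ`. -/
def law (θ β : ℝ) : Measure ℝ :=
  volume.withDensity (fun x => ENNReal.ofReal (pdf θ β x))

/-- The order statistic `X_{j,n}` of the sample `x 0, …, x (n - 1)`: its `j`-th smallest value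
(with multiplicity) for `1 ≤ j ≤ n`.  Outside this range it is set to `0`. -/
def orderStat (x : ℕ → ℝ) (n j : ℕ) : ℝ :=
  if h : 1 ≤ j ∧ j ≤ n then
    (fun i : Fin n => x i) (Tuple.sort (fun i : Fin n => x i) ⟨j - 1, by omega⟩)
  else 0

/-- Hill's estimator `k⁻¹ ∑_{j = 1}^{k} j (X_{n-j+1,n} - X_{n-j,n})` of the sample
`x 0, …, x (n - 1)`. -/
def hill (x : ℕ → ℝ) (n k : ℕ) : ℝ :=
  (1 / (k : ℝ)) * ∑ j ∈ Finset.Icc 1 k,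
    (j : ℝ) * (orderStat x n (n - j + 1) - orderStat x n (n - j))

lemma pdf_nonneg {θ β : ℝ} (hθ : 0 < θ) (hβ : 1 < β) (x : ℝ) : 0 ≤ pdf θ β x := by
  unfold pdf
  split_ifs with h
  · have h1 : 0 ≤ θ * x := by positivity
    have h2 : 0 ≤ β - 1 + θ * x := by linarith
    have h3 : 0 < β := by linarith
    positivity
  · exact le_rfl

/-- The survival function of the Pseudo-Lindley distribution. -/
lemma law_Ioi {θ β : ℝ} (hθ : 0 < θ) (hβ : 1 < β) {x : ℝ} (hx : 0 ≤ x) :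
    law θ β (Ioi x) = ENNReal.ofReal ((β + θ * x) * Real.exp (-(θ * x)) / β) := by
  have hβ0 : 0 < β := by linarith
  set G : ℝ → ℝ := fun y => -((β + θ * y) * Real.exp (-(θ * y)) / β) with hG
  have hd : ∀ y ∈ Ici x, HasDerivAt G (pdf θ β y) y := by
    intro y hy
    have hy0 : 0 ≤ y := le_trans hx hy
    have h1 : HasDerivAt (fun y : ℝ => θ * y) θ y := by
      simpa using (hasDerivAt_id y).const_mul θ
    have h2 := (((h1.const_add β).mul h1.neg.exp).div_const β).neg
    convert! h2 using 1
    simp only [pdf, if_pos hy0, Pi.neg_apply]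
    ring
  have hlim : Tendsto G atTop (𝓝 0) := by
    have hz : Tendsto (fun y : ℝ => θ * y) atTop atTop := tendsto_id.const_mul_atTop hθ
    have h0 := (Real.tendsto_pow_mul_exp_neg_atTop_nhds_zero 0).comp hz
    have h1 := (Real.tendsto_pow_mul_exp_neg_atTop_nhds_zero 1).comp hz
    have h2 := (((h0.const_mul β).add h1).div_const β).neg
    simp only [mul_zero, add_zero, zero_div, neg_zero] at h2
    refine h2.congr fun y => ?_
    simp only [hG, Function.comp, pow_zero, pow_one]
    ring
  have hnn : ∀ y ∈ Ioi x, 0 ≤ pdf θ β y := fun y _ => pdf_nonneg hθ hβ y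
  have hint := integrableOn_Ioi_deriv_of_nonneg' hd hnn hlim
  have hval := integral_Ioi_of_hasDerivAt_of_nonneg' hd hnn hlim
  rw [law, withDensity_apply _ measurableSet_Ioi,
    ← ofReal_integral_eq_lintegral_ofReal hint (ae_of_all _ (pdf_nonneg hθ hβ)), hval]
  simp [hG]

/-- The Pseudo-Lindley distribution is a probability distribution. -/
lemma isProbabilityMeasure_law {θ β : ℝ} (hθ : 0 < θ) (hβ : 1 < β) :
    IsProbabilityMeasure (law θ β) := by
  have hβ0 : β ≠ 0 := by linarith
  constructor
  have h0 : law θ β (Iic 0) = 0 := by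
    rw [law, withDensity_apply _ measurableSet_Iic, setLIntegral_congr Iio_ae_eq_Iic.symm,
      setLIntegral_congr_fun (g := fun _ => 0) measurableSet_Iio, lintegral_zero]
    intro y hy
    simp [pdf, not_le.2 (mem_Iio.1 hy)]
  rw [← Iic_union_Ioi (a := (0 : ℝ)), measure_union (Iic_disjoint_Ioi le_rfl) measurableSet_Ioi,
    h0, law_Ioi hθ hβ le_rfl]
  simp [hβ0]

/-- The cumulative distribution function of the Pseudo-Lindley distribution. -/
lemma cdf_law {θ β : ℝ} (hθ : 0 < θ) (hβ : 1 < β) {x : ℝ} (hx : 0 ≤ x) :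
    cdf (law θ β) x = 1 - (β + θ * x) * Real.exp (-(θ * x)) / β := by
  have := isProbabilityMeasure_law hθ hβ
  have hβ0 : 0 < β := by linarith
  rw [cdf_eq_real, ← compl_Ioi, probReal_compl_eq_one_sub measurableSet_Ioi, measureReal_def,
    law_Ioi hθ hβ hx, ENNReal.toReal_ofReal (by positivity)]

end

end PseudoLindley

/-!
The cumulative hazard function `cumHazard θ β`, equal to `θ x - log (1 + θ x / β)` for `x ≥ 0`,
maps the Pseudo-Lindley law to the standard exponential law (`law_map_cumHazard`). Being increasing,
it commutes with order statistics, so the proof compares the Hill estimator of the sample with that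
of its exponential transform.

For an exponential sample with `k < n` the Hill estimator is *exactly* distributed as the mean of
`k` independent exponential variables (`map_sum_max_eq`). By summation by parts, `k` times the
estimator is the total excess over the threshold `X_{n-k,n}` (`hill_eq_sum_max`). Decompose the
probability space according to which observation is the threshold and which `k` observations lie
above it. On each piece the characteristic function of the total excess is computed by Fubini's
theorem, given the threshold; by lack of memory each of the `k` excesses contributes the factor
`φ(t)`, the exponential characteristic function, and the pieces add up to `φ(t) ^ k`. The
classical central limit theorem then applies.

Above a threshold with transformed value `T`, the logarithmic correction in `cumHazard` distorts
increments by a relative error of at most `1 / T`, and the Hill estimator inherits this bound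
(`abs_hill_sub_hill_le`). By Chebyshev's inequality `T` exceeds `log n / 2` with high probability
(`measureReal_orderStat_le`), and `√k / log n → 0`, so that `θ` times the Hill estimator of the
sample and that of its transform agree up to `o(1 / √k)` in probability, and Slutsky's theorem
concludes.
-/

namespace PseudoLindley

/-! ### Order statistics of a finite sample -/

lemma orderStat_of_mem (x : ℕ → ℝ) {n j : ℕ} (h1 : 1 ≤ j) (h2 : j ≤ n) :
    orderStat x n j =
      x (Tuple.sort (fun i : Fin n => x i) ⟨j - 1, by omega⟩) := by
  rw [orderStat, dif_pos ⟨h1, h2⟩]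

lemma orderStat_mono (x : ℕ → ℝ) {n i j : ℕ} (hi : 1 ≤ i) (hij : i ≤ j) (hj : j ≤ n) :
    orderStat x n i ≤ orderStat x n j := by
  rw [orderStat_of_mem x hi (hij.trans hj), orderStat_of_mem x (hi.trans hij) hj]
  exact Tuple.monotone_sort (fun i : Fin n => x i)
    (show (⟨i - 1, by omega⟩ : Fin n) ≤ ⟨j - 1, by omega⟩ by
      simp only [Fin.mk_le_mk]; omega)

lemma orderStat_comp {g : ℝ → ℝ} (hg : Monotone g) (x : ℕ → ℝ) {n j : ℕ} (h1 : 1 ≤ j)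
    (h2 : j ≤ n) : orderStat (fun i => g (x i)) n j = g (orderStat x n j) := by
  rw [orderStat_of_mem _ h1 h2, orderStat_of_mem _ h1 h2]
  have := (Tuple.comp_sort_eq_comp_iff_monotone (f := fun i : Fin n => g (x i))
    (σ := Tuple.sort (fun i : Fin n => x i))).2
      (hg.comp (Tuple.monotone_sort (fun i : Fin n => x i)))
  exact (congrFun this ⟨j - 1, by omega⟩).symm

lemma sum_comp_orderStat (x : ℕ → ℝ) (n : ℕ) (f : ℝ → ℝ) :
    ∑ i ∈ Finset.range n, f (x i) = ∑ i ∈ Finset.range n, f (orderStat x n (i + 1)) := by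
  rw [Finset.sum_range, Finset.sum_range,
    ← Equiv.sum_comp (Tuple.sort (fun i : Fin n => x i)) (fun i : Fin n => f (x i))]
  refine Finset.sum_congr rfl fun i _ => ?_
  rw [orderStat_of_mem x (by omega) (by omega)]
  rfl

/-- The `j`-th order statistic is at most `u` if and only if at least `j` observations are. This
gives the measurability of order statistics and a tail bound for them in terms of a sum of
independent indicators. -/
lemma orderStat_le_iff (x : ℕ → ℝ) {n j : ℕ} (h1 : 1 ≤ j) (h2 : j ≤ n) (u : ℝ) :
    orderStat x n j ≤ u ↔ (j : ℝ) ≤ ∑ i ∈ Finset.range n, (Iic u).indicator 1 (x i) := by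
  rw [sum_comp_orderStat x n ((Iic u).indicator 1)]
  constructor
  · intro h
    calc (j : ℝ) = ∑ i ∈ Finset.range j, (Iic u).indicator 1 (orderStat x n (i + 1)) := by
          rw [Finset.sum_congr rfl (g := fun _ => (1 : ℝ))]
          · simp
          · intro i hi
            rw [Finset.mem_range] at hi
            rw [indicator_of_mem]
            · rfl
            · exact (orderStat_mono x (by omega) (by omega) h2).trans h
      _ ≤ _ := Finset.sum_le_sum_of_subset_of_nonneg (Finset.range_mono h2)
          fun i _ _ => indicator_nonneg (fun _ _ => zero_le_one) _
  · intro h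
    by_contra! hu
    have h3 : ∑ i ∈ Finset.range n, (Iic u).indicator (1 : ℝ → ℝ) (orderStat x n (i + 1))
        ≤ ∑ i ∈ Finset.range (j - 1), (1 : ℝ) := by
      rw [← Finset.sum_subset (Finset.range_mono (show j - 1 ≤ n by omega))]
      · exact Finset.sum_le_sum fun i _ => indicator_le' (g := fun _ => (1 : ℝ))
          (fun _ _ => le_rfl) (fun _ _ => zero_le_one) _
      · intro i hi hij
        rw [Finset.mem_range] at hi hij
        exact indicator_of_notMem (s := Iic _) (not_le.2 (hu.trans_le
          (orderStat_mono x h1 (by omega) (by omega)))) _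
    simp only [Finset.sum_const, Finset.card_range, nsmul_eq_mul, mul_one] at h3
    rw [Nat.cast_sub h1] at h3
    push_cast at h3
    linarith

lemma measurable_orderStat {Ω : Type*} [MeasurableSpace Ω] {Y : ℕ → Ω → ℝ}
    (hY : ∀ i, Measurable (Y i)) (n j : ℕ) :
    Measurable fun ω => orderStat (fun i => Y i ω) n j := by
  by_cases h : 1 ≤ j ∧ j ≤ n
  · refine measurable_of_Iic fun u => ?_
    simp only [preimage, mem_Iic, orderStat_le_iff _ h.1 h.2]
    refine measurableSet_le measurable_const (Finset.measurable_sum _ fun i _ => ?_)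
    exact (measurable_const.indicator measurableSet_Iic).comp (hY i)
  · simp only [orderStat, dif_neg h]
    exact measurable_const

lemma measurable_hill {Ω : Type*} [MeasurableSpace Ω] {Y : ℕ → Ω → ℝ}
    (hY : ∀ i, Measurable (Y i)) (n k : ℕ) :
    Measurable fun ω => hill (fun i => Y i ω) n k := by
  unfold hill
  refine (Finset.measurable_sum _ fun j _ => ?_).const_mul _
  exact ((measurable_orderStat hY n _).sub (measurable_orderStat hY n _)).const_mul _

lemma sum_succ_mul_sub (a : ℕ → ℝ) (k : ℕ) :
    ∑ j ∈ Finset.range k, ((j + 1 : ℕ) : ℝ) * (a j - a (j + 1)) =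
      ∑ j ∈ Finset.range k, (a j - a k) := by
  induction k with
  | zero => simp
  | succ k ih =>
    rw [Finset.sum_range_succ, ih, Finset.sum_range_succ]
    simp only [Finset.sum_sub_distrib, Finset.sum_const, Finset.card_range, nsmul_eq_mul]
    push_cast
    ring

/-- Summation by parts turns the weighted spacings into the total excess of the sample over the
threshold `X_{n-k,n}`, a symmetric function of the sample once the threshold is known. -/
lemma hill_eq_sum_max (x : ℕ → ℝ) {n k : ℕ} (hkn : k < n) :
    hill x n k = (1 / (k : ℝ)) *
      ∑ i ∈ Finset.range n, max (x i - orderStat x n (n - k)) 0 := by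
  rw [hill]
  congr 1
  rw [sum_comp_orderStat x n (fun y => max (y - orderStat x n (n - k)) 0),
    ← Finset.sum_range_reflect, Finset.range_eq_Ico,
    ← Finset.sum_Ico_consecutive _ (Nat.zero_le k) hkn.le,
    Finset.sum_eq_zero (s := Finset.Ico k n), add_zero, ← Finset.range_eq_Ico]
  · have h1 : ∀ j ∈ Finset.range k,
        max (orderStat x n (n - 1 - j + 1) - orderStat x n (n - k)) 0 =
          orderStat x n (n - j) - orderStat x n (n - k) := by
      intro j hj
      rw [Finset.mem_range] at hj
      rw [show n - 1 - j + 1 = n - j by omega, max_eq_left]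
      exact sub_nonneg.2 (orderStat_mono x (by omega) (by omega) (by omega))
    rw [Finset.sum_congr rfl h1, ← sum_succ_mul_sub (fun j => orderStat x n (n - j)),
      ← Finset.Ico_add_one_right_eq_Icc, Finset.sum_Ico_eq_sum_range]
    refine Finset.sum_congr rfl fun j hj => ?_
    rw [Finset.mem_range] at hj
    rw [add_comm 1 j, show n - (j + 1) + 1 = n - j by omega]
  · intro j hj
    rw [Finset.mem_Ico] at hj
    rw [max_eq_right]
    exact sub_nonpos.2 (orderStat_mono x (by omega) (by omega) (by omega))

/-- If the observations with index in `A` exceed the `i`-th one and the remaining ones are below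
it, then the `i`-th observation is the threshold. -/
lemma orderStat_eq_of_separated (x : ℕ → ℝ) {n : ℕ} (i : Fin n) (A : Finset (Fin n))
    (hiA : i ∉ A) (hA : ∀ a ∈ A, x i < x a) (hA' : ∀ b ∉ A, b ≠ i → x b < x i) :
    orderStat x n (n - A.card) = x i := by
  have hcard : A.card < n := by
    simpa using Finset.card_lt_univ_of_notMem hiA
  apply le_antisymm
  · rw [orderStat_le_iff x (by omega) (by omega), Finset.sum_range]
    rw [← Finset.sum_add_sum_compl A, Finset.sum_eq_zero, zero_add,
      Finset.sum_congr rfl (g := fun _ => (1 : ℝ))]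
    · simp [Finset.card_compl]
    · intro b hb
      rw [Finset.mem_compl] at hb
      rw [indicator_of_mem]
      · rfl
      · by_cases hbi : b = i
        · exact (congrArg x (congrArg Fin.val hbi)).le
        · exact (hA' b hb hbi).le
    · intro a ha
      exact indicator_of_notMem (s := Iic _) (not_le.2 (hA a ha)) _
  · by_contra! hlt
    have h := (orderStat_le_iff x (j := n - A.card) (by omega) (by omega)
      (orderStat x n (n - A.card))).1 le_rfl
    set T := orderStat x n (n - A.card)
    have h2 : ∑ j ∈ Finset.range n, (Iic T).indicator (1 : ℝ → ℝ) (x j) ≤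
        ∑ j ∈ (insert i A)ᶜ, (1 : ℝ) := by
      rw [Finset.sum_range, ← Finset.sum_add_sum_compl (insert i A), Finset.sum_eq_zero, zero_add]
      · exact Finset.sum_le_sum fun i _ => indicator_le' (g := fun _ => (1 : ℝ))
          (fun _ _ => le_rfl) (fun _ _ => zero_le_one) _
      · intro a ha
        refine indicator_of_notMem (s := Iic _) (not_le.2 ?_) _
        rcases Finset.mem_insert.1 ha with rfl | ha
        · exact hlt
        · exact hlt.trans (hA a ha)
    rw [Finset.sum_const, Finset.card_compl, Finset.card_insert_of_notMem hiA, Fintype.card_fin,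
      nsmul_eq_mul, mul_one] at h2
    have h3 := h.trans h2
    have : n - A.card ≤ n - (A.card + 1) := by exact_mod_cast h3
    omega

/-! ### Reduction to the exponential distribution -/

/-- The cumulative hazard function `-log (1 - F)` of the Pseudo-Lindley distribution on `x ≥ 0`.
For `x < 0` it is continued by `θ * x`, which makes it strictly increasing on all of `ℝ`. -/
noncomputable def cumHazard (θ β x : ℝ) : ℝ := θ * x - Real.log (1 + max (θ * x) 0 / β)

@[fun_prop]
lemma continuous_cumHazard {θ β : ℝ} (hβ : 1 < β) : Continuous (cumHazard θ β) := by
  have h0 : 0 < β := by linarith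
  have h : Continuous fun x => 1 + max (θ * x) 0 / β := by fun_prop
  exact (continuous_const_mul θ).sub (h.log fun x => by positivity)

lemma log_one_add_le {θ β a b : ℝ} (hθ : 0 < θ) (hβ : 1 < β) (hab : a ≤ b) :
    Real.log (1 + max (θ * a) 0 / β) ≤ Real.log (1 + max (θ * b) 0 / β) := by
  have h0 : 0 < β := by linarith
  gcongr

lemma log_one_add_sub_le {θ β a b : ℝ} (hθ : 0 < θ) (hβ : 1 < β) (hab : a ≤ b) :
    Real.log (1 + max (θ * b) 0 / β) - Real.log (1 + max (θ * a) 0 / β) ≤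
      θ * (b - a) / (β + max (θ * a) 0) := by
  have h0 : 0 < β := by linarith
  have hA : 0 ≤ max (θ * a) 0 := le_max_right _ _
  have hB : 0 ≤ max (θ * b) 0 := le_max_right _ _
  have hBA : max (θ * b) 0 - max (θ * a) 0 ≤ θ * (b - a) := by
    have h1 : 0 ≤ θ * (b - a) := mul_nonneg hθ.le (by linarith)
    rcases max_cases (θ * b) 0 with h | h <;> rcases max_cases (θ * a) 0 with h' | h' <;>
      nlinarith
  set A := max (θ * a) 0
  set B := max (θ * b) 0
  have hA' : 0 < β + A := by linarith
  rw [← Real.log_div (by positivity) (by positivity)]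
  refine (Real.log_le_sub_one_of_pos (by positivity)).trans ?_
  have : (1 + B / β) / (1 + A / β) - 1 = (B - A) / (β + A) := by
    have : (1 + A / β) ≠ 0 := by positivity
    field_simp
    ring
  rw [this]
  gcongr

lemma strictMono_cumHazard {θ β : ℝ} (hθ : 0 < θ) (hβ : 1 < β) : StrictMono (cumHazard θ β) := by
  intro a b hab
  have h1 := log_one_add_sub_le hθ hβ hab.le
  have hA : 0 ≤ max (θ * a) 0 := le_max_right _ _
  have hd : 0 < θ * (b - a) := mul_pos hθ (by linarith)
  have h2 : θ * (b - a) / (β + max (θ * a) 0) < θ * (b - a) := div_lt_self hd (by linarith)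
  unfold cumHazard
  linarith

/-- Above a threshold `a` the hazard transform distorts increments by a relative error of at most
`1 / cumHazard θ β a`. -/
lemma mul_sub_sub_cumHazard_le {θ β a b : ℝ} (hθ : 0 < θ) (hβ : 1 < β) (hab : a ≤ b)
    (ha : 0 < cumHazard θ β a) :
    θ * (b - a) - (cumHazard θ β b - cumHazard θ β a) ≤
      (cumHazard θ β b - cumHazard θ β a) / cumHazard θ β a := by
  have h0 : 0 < β := by linarith
  have h1 := log_one_add_sub_le hθ hβ hab
  have hA : 0 ≤ max (θ * a) 0 := le_max_right _ _
  have hA2 : θ * a ≤ max (θ * a) 0 := le_max_left _ _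
  have hlog : 0 ≤ Real.log (1 + max (θ * a) 0 / β) :=
    Real.log_nonneg (by have : 0 ≤ max (θ * a) 0 / β := by positivity
                        linarith)
  have hg : cumHazard θ β a ≤ max (θ * a) 0 := by unfold cumHazard; linarith
  have heq : θ * (b - a) - (cumHazard θ β b - cumHazard θ β a) =
      Real.log (1 + max (θ * b) 0 / β) - Real.log (1 + max (θ * a) 0 / β) := by
    unfold cumHazard; ring
  have hd : 0 ≤ θ * (b - a) := mul_nonneg hθ.le (by linarith)
  rw [← heq, le_div_iff₀ (by linarith)] at h1
  have he : 0 ≤ θ * (b - a) - (cumHazard θ β b - cumHazard θ β a) := by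
    rw [heq]; exact sub_nonneg.2 (log_one_add_le hθ hβ hab)
  rw [le_div_iff₀ ha]
  set e := cumHazard θ β b - cumHazard θ β a
  set d := θ * (b - a)
  have hc : cumHazard θ β a + 1 ≤ β + max (θ * a) 0 := by linarith
  nlinarith [mul_le_mul_of_nonneg_left hc he]

lemma cumHazard_sub_le {θ β a b : ℝ} (hθ : 0 < θ) (hβ : 1 < β) (hab : a ≤ b) :
    cumHazard θ β b - cumHazard θ β a ≤ θ * (b - a) := by
  have := log_one_add_le hθ hβ hab
  unfold cumHazard
  linarith

lemma cumHazard_zero (θ β : ℝ) : cumHazard θ β 0 = 0 := by simp [cumHazard]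

lemma exp_neg_cumHazard {θ β x : ℝ} (hθ : 0 < θ) (hβ : 1 < β) (hx : 0 ≤ x) :
    Real.exp (-cumHazard θ β x) = (β + θ * x) * Real.exp (-(θ * x)) / β := by
  have h0 : 0 < β := by linarith
  have h1 : 0 ≤ θ * x := by positivity
  rw [cumHazard, max_eq_left h1, neg_sub, Real.exp_sub, Real.exp_log (by positivity), Real.exp_neg]
  field_simp

lemma tendsto_cumHazard_atTop {θ β : ℝ} (hθ : 0 < θ) (hβ : 1 < β) :
    Tendsto (cumHazard θ β) atTop atTop := by
  have h0 : 0 < β := by linarith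
  refine tendsto_atTop_mono' _ ?_
    (tendsto_id.const_mul_atTop (show 0 < θ * (1 - 1 / β) by
      have : 1 / β < 1 := by rw [div_lt_one h0]; exact hβ
      exact mul_pos hθ (by linarith)))
  filter_upwards [eventually_ge_atTop 0] with x hx
  have h := log_one_add_sub_le hθ hβ hx
  simp only [mul_zero, max_self, zero_div, add_zero, Real.log_one, sub_zero] at h
  have h2 : θ * (1 - 1 / β) * id x = θ * x - θ * x / β := by
    simp only [id]; ring
  rw [h2, cumHazard]
  linarith

lemma law_map_cumHazard {θ β : ℝ} (hθ : 0 < θ) (hβ : 1 < β) :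
    (law θ β).map (cumHazard θ β) = expMeasure 1 := by
  have h0 : 0 < β := by linarith
  have hmeas : Measurable (cumHazard θ β) := (continuous_cumHazard hβ).measurable
  have := isProbabilityMeasure_law hθ hβ
  have := isProbabilityMeasure_expMeasure zero_lt_one
  have : IsProbabilityMeasure ((law θ β).map (cumHazard θ β)) :=
    Measure.isProbabilityMeasure_map hmeas.aemeasurable
  refine Measure.eq_of_cdf _ _ ?_
  ext u
  rw [cdf_expMeasure_eq zero_lt_one, cdf_eq_real, map_measureReal_apply hmeas measurableSet_Iic]
  split_ifs with hu
  · obtain ⟨x, hx, rfl⟩ : ∃ x, 0 ≤ x ∧ cumHazard θ β x = u := by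
      obtain ⟨y, hy0, hy⟩ := ((eventually_ge_atTop 0).and
        ((tendsto_cumHazard_atTop hθ hβ).eventually_ge_atTop u)).exists
      obtain ⟨x, hx, hxu⟩ := intermediate_value_Icc hy0 (continuous_cumHazard hβ).continuousOn
        (show u ∈ Icc _ _ from ⟨by rwa [cumHazard_zero], hy⟩)
      exact ⟨x, hx.1, hxu⟩
    have hpre : cumHazard θ β ⁻¹' Iic (cumHazard θ β x) = Iic x := by
      ext y
      simp [(strictMono_cumHazard hθ hβ).le_iff_le]
    rw [hpre, ← cdf_eq_real, cdf_law hθ hβ hx, one_mul, exp_neg_cumHazard hθ hβ hx]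
  · refine le_antisymm ?_ measureReal_nonneg
    have hsub : cumHazard θ β ⁻¹' Iic u ⊆ Iic 0 := by
      intro y hy
      rw [mem_preimage, mem_Iic] at hy
      refine ((strictMono_cumHazard hθ hβ).lt_iff_lt.1 ?_).le
      rw [cumHazard_zero]
      linarith
    refine (measureReal_mono hsub).trans ?_
    rw [← cdf_eq_real, cdf_law hθ hβ le_rfl]
    simp [h0.ne']

/-! ### The standard exponential distribution -/

instance : IsProbabilityMeasure (expMeasure 1) := isProbabilityMeasure_expMeasure zero_lt_one

instance : NullSingletonClass (expMeasure 1) := by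
  unfold expMeasure gammaMeasure
  infer_instance

lemma integral_expMeasure {E : Type*} [NormedAddCommGroup E] [NormedSpace ℝ E] (f : ℝ → E) :
    ∫ x, f x ∂(expMeasure 1) = ∫ x, (Ici 0).indicator (fun x => Real.exp (-x) • f x) x := by
  rw [expMeasure, gammaMeasure, integral_withDensity_eq_integral_toReal_smul]
  · refine integral_congr_ae (ae_of_all _ fun x => ?_)
    change (exponentialPDF 1 x).toReal • f x = _
    rw [exponentialPDF_eq]
    by_cases hx : 0 ≤ x
    · rw [if_pos hx, indicator_of_mem (s := Ici 0) hx, ENNReal.toReal_ofReal (by positivity)]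
      simp
    · rw [if_neg hx, indicator_of_notMem (s := Ici 0) hx]
      simp
  · exact (measurable_gammaPDFReal 1 1).ennreal_ofReal
  · exact ae_of_all _ fun x => ENNReal.ofReal_lt_top

lemma ae_nonneg_expMeasure : ∀ᵐ x ∂(expMeasure 1), 0 ≤ x := by
  have h := cdf_expMeasure_eq zero_lt_one 0
  rw [cdf_eq_real] at h
  simp only [le_refl, if_true, mul_zero, neg_zero, Real.exp_zero, sub_self] at h
  rw [measureReal_eq_zero_iff] at h
  rw [ae_iff]
  refine measure_mono_null (fun x hx => ?_) h
  exact (not_le.1 hx).le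

/-- Lack of memory of the exponential distribution. -/
lemma integral_expMeasure_shift (c : ℝ → ℂ) {x : ℝ} (hx : 0 ≤ x) :
    ∫ y, (Ioi x).indicator (fun y => c (y - x)) y ∂(expMeasure 1) =
      Real.exp (-x) * ∫ y, c y ∂(expMeasure 1) := by
  have h0 : ∫ y, c y ∂(expMeasure 1) = ∫ y, (Ioi 0).indicator (fun y => Real.exp (-y) • c y) y := by
    rw [integral_expMeasure, integral_indicator measurableSet_Ici,
      integral_indicator measurableSet_Ioi, integral_Ici_eq_integral_Ioi]
  rw [h0, integral_expMeasure, ← integral_const_mul, ← integral_sub_right_eq_self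
    (fun y => (Real.exp (-x) : ℂ) * (Ioi 0).indicator (fun y => Real.exp (-y) • c y) y) x]
  congr 1
  ext y
  by_cases hy : x < y
  · rw [indicator_of_mem (s := Ici 0) (hx.trans hy.le), indicator_of_mem (s := Ioi x) hy,
      indicator_of_mem (s := Ioi 0) (sub_pos.2 hy), Complex.real_smul, Complex.real_smul,
      ← mul_assoc, ← Complex.ofReal_mul, ← Real.exp_add]
    ring_nf
  · rw [indicator_of_notMem (s := Ioi 0) (fun h => hy (sub_pos.1 h))]
    by_cases hy0 : 0 ≤ y
    · rw [indicator_of_mem (s := Ici 0) hy0, indicator_of_notMem (s := Ioi x) hy]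
      simp
    · rw [indicator_of_notMem (s := Ici 0) hy0]
      simp

lemma integral_pow_expMeasure (p : ℕ) : ∫ x, x ^ p ∂(expMeasure 1) = (p.factorial : ℝ) := by
  rw [integral_expMeasure, integral_indicator measurableSet_Ici, integral_Ici_eq_integral_Ioi,
    ← Real.Gamma_nat_eq_factorial, Real.Gamma_eq_integral (by positivity)]
  refine setIntegral_congr_fun measurableSet_Ioi fun x hx => ?_
  simp

lemma memLp_id_expMeasure : MemLp id 2 (expMeasure 1) := by
  rw [memLp_two_iff_integrable_sq measurable_id.aestronglyMeasurable]
  -- a function with non-zero Bochner integral is integrable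
  by_contra h
  have h2 := integral_pow_expMeasure 2
  exact absurd ((integral_undef h).symm.trans h2) (by norm_num)

lemma variance_id_expMeasure : Var[id; expMeasure 1] = 1 := by
  rw [variance_eq_sub memLp_id_expMeasure]
  have h1 := integral_pow_expMeasure 1
  have h2 := integral_pow_expMeasure 2
  simp only [pow_one, Nat.factorial_one, Nat.factorial_two] at h1 h2
  simp only [Pi.pow_apply, id, h1, h2]
  norm_num

/-! ### The law of the total excess of an exponential sample -/

/-- The set of samples in which exactly the observations with index in `A` exceed the `i`-th one,
and all others are strictly below it. -/
def separated {n : ℕ} (i : Fin n) (A : Finset (Fin n)) : Set (Fin n → ℝ) :=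
  {z | (∀ a ∈ A, z i < z a) ∧ ∀ b ∉ A, b ≠ i → z b < z i}

lemma measurableSet_separated {n : ℕ} (i : Fin n) (A : Finset (Fin n)) :
    MeasurableSet (separated i A) := by
  have : separated i A =
      (⋂ a ∈ A, {z | z i < z a}) ∩ ⋂ b, ⋂ (_ : b ∉ A), ⋂ (_ : b ≠ i), {z | z b < z i} := by
    ext z
    simp [separated]
  rw [this]
  have hlt : ∀ a b : Fin n, MeasurableSet {z : Fin n → ℝ | z a < z b} := fun a b =>
    measurableSet_lt (f := fun z : Fin n → ℝ => z a) (g := fun z : Fin n → ℝ => z b)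
      (measurable_pi_apply a) (measurable_pi_apply b)
  refine (Finset.measurableSet_biInter _ fun a _ => hlt i a).inter ?_
  exact MeasurableSet.iInter fun b => MeasurableSet.iInter fun _ => MeasurableSet.iInter fun _ =>
    hlt b i

/-- The pairs `(i, A)` with `i ∉ A` and `A` of size `k`. -/
def thresholdPairs (n k : ℕ) : Finset (Fin n × Finset (Fin n)) :=
  Finset.univ.filter fun p => p.1 ∉ p.2 ∧ p.2.card = k

lemma exists_separated (x : ℕ → ℝ) {n k : ℕ} (hkn : k < n)
    (hx : Function.Injective fun i : Fin n => x i) :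
    ∃ p ∈ thresholdPairs n k, (fun i : Fin n => x i) ∈ separated p.1 p.2 := by
  set z : Fin n → ℝ := fun i => x i
  set σ := Tuple.sort z
  have hσ : StrictMono (z ∘ σ) :=
    (Tuple.monotone_sort z).strictMono_of_injective (hx.comp σ.injective)
  let m : Fin n := ⟨n - 1 - k, by omega⟩
  refine ⟨(σ m, (Finset.Ioi m).map σ.toEmbedding), ?_, ?_, ?_⟩
  · simp only [thresholdPairs, Finset.mem_filter, Finset.mem_univ, true_and]
    refine ⟨by simp, ?_⟩
    rw [Finset.card_map, Fin.card_Ioi]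
    simp only [m]
    omega
  · intro a ha
    obtain ⟨j, hj, rfl⟩ := Finset.mem_map.1 ha
    exact hσ (Finset.mem_Ioi.1 hj)
  · intro b hb hbi
    obtain ⟨j, rfl⟩ := σ.surjective b
    have h1 : ¬ m < j := fun h => hb (Finset.mem_map.2 ⟨j, Finset.mem_Ioi.2 h, rfl⟩)
    have h2 : j ≠ m := fun h => hbi (by rw [h])
    exact hσ (lt_of_le_of_ne (not_lt.1 h1) h2)

lemma separated_unique (x : ℕ → ℝ) {n k : ℕ} (hx : Function.Injective fun i : Fin n => x i)
    {p q : Fin n × Finset (Fin n)} (hp : p ∈ thresholdPairs n k) (hq : q ∈ thresholdPairs n k)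
    (hpx : (fun i : Fin n => x i) ∈ separated p.1 p.2)
    (hqx : (fun i : Fin n => x i) ∈ separated q.1 q.2) : p = q := by
  simp only [thresholdPairs, Finset.mem_filter, Finset.mem_univ, true_and] at hp hq
  have h1 := orderStat_eq_of_separated x p.1 p.2 hp.1 hpx.1 hpx.2
  have h2 := orderStat_eq_of_separated x q.1 q.2 hq.1 hqx.1 hqx.2
  rw [hp.2] at h1
  rw [hq.2] at h2
  have h3 : p.1 = q.1 := hx (h1.symm.trans h2)
  have key : ∀ r : Fin n × Finset (Fin n), r.1 ∉ r.2 →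
      (fun i : Fin n => x i) ∈ separated r.1 r.2 → ∀ a, a ∈ r.2 ↔ x r.1 < x a := by
    intro r hr hrx a
    refine ⟨fun h => hrx.1 a h, fun h => ?_⟩
    by_contra ha
    exact lt_asymm h (hrx.2 a ha (by rintro rfl; exact lt_irrefl _ h))
  refine Prod.ext h3 (Finset.ext fun a => ?_)
  rw [key p hp.1 hpx, key q hq.1 hqx, h3]

lemma sum_indicator_separated (x : ℕ → ℝ) {n k : ℕ} (hkn : k < n)
    (hx : Function.Injective fun i : Fin n => x i) (F : ℂ) :
    ∑ p ∈ thresholdPairs n k,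
      (separated p.1 p.2).indicator (fun _ => F) (fun i : Fin n => x i) = F := by
  obtain ⟨p, hp, hpx⟩ := exists_separated x hkn hx
  rw [Finset.sum_eq_single_of_mem p hp, indicator_of_mem hpx]
  intro q hq hqp
  refine indicator_of_notMem (fun hqx => hqp ?_) _
  exact separated_unique x hx hq hp hqx hpx

/-- Where `separated i A` holds, the total excess over the threshold is carried by `A`. -/
lemma sum_max_of_separated (x : ℕ → ℝ) {n k : ℕ} {p : Fin n × Finset (Fin n)}
    (hp : p ∈ thresholdPairs n k) (hpx : (fun i : Fin n => x i) ∈ separated p.1 p.2) :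
    ∑ i ∈ Finset.range n, max (x i - orderStat x n (n - k)) 0 =
      ∑ a ∈ p.2, (x a - x p.1) := by
  simp only [thresholdPairs, Finset.mem_filter, Finset.mem_univ, true_and] at hp
  have h1 := orderStat_eq_of_separated x p.1 p.2 hp.1 hpx.1 hpx.2
  rw [hp.2] at h1
  rw [h1, Finset.sum_range, ← Finset.sum_subset (Finset.subset_univ p.2)]
  · exact Finset.sum_congr rfl fun a ha => max_eq_left (sub_nonneg.2 (hpx.1 a ha).le)
  · intro b _ hb
    refine max_eq_right (sub_nonpos.2 ?_)
    by_cases hbi : b = p.1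
    · rw [hbi]
    · exact (hpx.2 b hb hbi).le

/-- The factor contributed by one observation, with value `p.2`, to the integrand on
`separated i A` when the `i`-th observation has the value `p.1`; `b` tells whether the observation
belongs to `A`. -/
noncomputable def separatedFactor (c : ℝ → ℂ) (b : Bool) (p : ℝ × ℝ) : ℂ :=
  if b then {p : ℝ × ℝ | p.1 < p.2}.indicator (fun p => c (p.2 - p.1)) p
  else {p : ℝ × ℝ | p.2 < p.1}.indicator 1 p

lemma measurable_separatedFactor {c : ℝ → ℂ} (hc : Measurable c) (b : Bool) :
    Measurable (separatedFactor c b) := by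
  cases b
  · simpa [separatedFactor] using!
      measurable_one.indicator (measurableSet_lt measurable_snd measurable_fst)
  · simpa [separatedFactor] using!
      (hc.comp (measurable_snd.sub measurable_fst)).indicator
        (measurableSet_lt measurable_fst measurable_snd)

lemma norm_separatedFactor_le {c : ℝ → ℂ} (hc : ∀ x, ‖c x‖ ≤ 1) (b : Bool) (p : ℝ × ℝ) :
    ‖separatedFactor c b p‖ ≤ 1 := by
  cases b
  · simp only [separatedFactor, Bool.false_eq_true, if_false]
    exact (norm_indicator_le_norm_self _ _).trans (by simp)
  · simp only [separatedFactor, if_true]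
    exact (norm_indicator_le_norm_self _ _).trans (hc _)

lemma integral_separatedFactor (c : ℝ → ℂ) (b : Bool) {x : ℝ} (hx : 0 ≤ x) :
    ∫ y, separatedFactor c b (x, y) ∂(expMeasure 1) =
      (if b then (Real.exp (-x) : ℂ) else ((expMeasure 1).real (Iio x) : ℂ)) *
        (if b then ∫ y, c y ∂(expMeasure 1) else 1) := by
  cases b
  · simp only [separatedFactor, Bool.false_eq_true, if_false, mul_one]
    rw [← integral_indicator_one measurableSet_Iio, ← integral_complex_ofReal]
    refine integral_congr_ae (ae_of_all _ fun y => ?_)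
    by_cases hy : y < x <;> simp [indicator, hy]
  · simp only [separatedFactor, if_true]
    rw [← integral_expMeasure_shift c hx]
    rfl

lemma indicator_separated_eq_prod {m : ℕ} (c : ℝ → ℂ) (i : Fin (m + 1))
    (A : Finset (Fin (m + 1))) (hiA : i ∉ A) (z : Fin (m + 1) → ℝ) :
    (separated i A).indicator (fun z => ∏ a ∈ A, c (z a - z i)) z =
      ∏ j : Fin m, separatedFactor c (decide (i.succAbove j ∈ A)) (z i, z (i.succAbove j)) := by
  have hsplit : ∀ f : Fin (m + 1) → ℂ, ∏ a ∈ A, f a =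
      ∏ j : Fin m, if i.succAbove j ∈ A then f (i.succAbove j) else 1 := by
    intro f
    rw [← Finset.univ_inter A, ← Finset.prod_ite_mem, Finset.univ_inter,
      Fin.prod_univ_succAbove _ i, if_neg hiA, one_mul]
  by_cases hz : z ∈ separated i A
  · rw [indicator_of_mem hz, hsplit]
    refine Finset.prod_congr rfl fun j _ => ?_
    by_cases hj : i.succAbove j ∈ A
    · have := hz.1 _ hj
      simp [separatedFactor, hj, indicator, this]
    · have := hz.2 _ hj (Fin.succAbove_ne i j)
      simp [separatedFactor, hj, indicator, this]
  · rw [indicator_of_notMem hz]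
    symm
    have : ∃ j : Fin m, separatedFactor c (decide (i.succAbove j ∈ A))
        (z i, z (i.succAbove j)) = 0 := by
      by_contra! hne
      refine hz ⟨fun a ha => ?_, fun b hb hbi => ?_⟩
      · obtain ⟨j, rfl⟩ := Fin.exists_succAbove_eq (show a ≠ i by rintro rfl; exact hiA ha)
        by_contra hlt
        exact hne j (by simp [separatedFactor, ha, indicator, hlt])
      · obtain ⟨j, rfl⟩ := Fin.exists_succAbove_eq hbi
        by_contra hlt
        exact hne j (by simp [separatedFactor, hb, indicator, hlt])
    obtain ⟨j, hj⟩ := this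
    exact Finset.prod_eq_zero (Finset.mem_univ j) hj

/-- The factor involving the values of the observations below the threshold does not depend on `c`,
which makes it computable by comparison with `c = 1`. -/
lemma integral_indicator_separated {m : ℕ} {c : ℝ → ℂ} (hc : Measurable c)
    (hc1 : ∀ x, ‖c x‖ ≤ 1) (i : Fin (m + 1)) (A : Finset (Fin (m + 1))) (hiA : i ∉ A) :
    ∫ z, (separated i A).indicator (fun z => ∏ a ∈ A, c (z a - z i)) z
        ∂(Measure.pi fun _ : Fin (m + 1) => expMeasure 1) =
      (∫ x, ∏ j : Fin m, (if i.succAbove j ∈ A then (Real.exp (-x) : ℂ)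
        else ((expMeasure 1).real (Iio x) : ℂ)) ∂(expMeasure 1)) *
      (∫ y, c y ∂(expMeasure 1)) ^ A.card := by
  let μ : Fin (m + 1) → Measure ℝ := fun _ => expMeasure 1
  let G : ℝ × (Fin m → ℝ) → ℂ := fun q =>
    ∏ j : Fin m, separatedFactor c (decide (i.succAbove j ∈ A)) (q.1, q.2 j)
  have hG : Measurable G := Finset.measurable_prod _ fun j _ =>
    (measurable_separatedFactor hc _).comp
      (measurable_fst.prodMk ((measurable_pi_apply j).comp measurable_snd))
  have hG1 : ∀ q, ‖G q‖ ≤ 1 := fun q => by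
    rw [norm_prod]
    exact Finset.prod_le_one (fun _ _ => norm_nonneg _) fun j _ => norm_separatedFactor_le hc1 _ _
  have h1 : ∫ z, (separated i A).indicator (fun z => ∏ a ∈ A, c (z a - z i)) z ∂(Measure.pi μ) =
      ∫ q, G q ∂((expMeasure 1).prod (Measure.pi fun _ : Fin m => expMeasure 1)) := by
    rw [← (measurePreserving_piFinSuccAbove μ i).integral_comp'
      (g := G)]
    refine integral_congr_ae (ae_of_all _ fun z => ?_)
    exact indicator_separated_eq_prod c i A hiA z
  have hcard : ∀ r : ℂ, ∏ j : Fin m, (if i.succAbove j ∈ A then r else 1) = r ^ A.card := by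
    intro r
    rw [← Finset.prod_const, ← Finset.univ_inter A, ← Finset.prod_ite_mem, Finset.univ_inter,
      Fin.prod_univ_succAbove _ i, if_neg hiA, one_mul]
  refine h1.trans ?_
  rw [integral_prod G (Integrable.of_bound hG.aestronglyMeasurable 1 (ae_of_all _ hG1)),
    ← integral_mul_const]
  refine integral_congr_ae ?_
  filter_upwards [ae_nonneg_expMeasure] with x hx
  simp only [G]
  rw [integral_fintype_prod_eq_prod
    (f := fun j y => separatedFactor c (decide (i.succAbove j ∈ A)) (x, y)), ← hcard,
    ← Finset.prod_mul_distrib]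
  refine Finset.prod_congr rfl fun j _ => ?_
  rw [integral_separatedFactor c _ hx]
  simp only [decide_eq_true_eq]

/-- Given which observations exceed the `i`-th one, their excesses are independent of this
event and again standard exponential. -/
lemma integral_indicator_separated_eq {m : ℕ} {c : ℝ → ℂ} (hc : Measurable c)
    (hc1 : ∀ x, ‖c x‖ ≤ 1) (i : Fin (m + 1)) (A : Finset (Fin (m + 1))) (hiA : i ∉ A) :
    ∫ z, (separated i A).indicator (fun z => ∏ a ∈ A, c (z a - z i)) z
        ∂(Measure.pi fun _ : Fin (m + 1) => expMeasure 1) =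
      (∫ y, c y ∂(expMeasure 1)) ^ A.card *
      ∫ z, (separated i A).indicator (fun _ => (1 : ℂ)) z
        ∂(Measure.pi fun _ : Fin (m + 1) => expMeasure 1) := by
  have h1 := integral_indicator_separated (c := fun _ => 1) measurable_const (by simp) i A hiA
  simp only [Finset.prod_const_one, integral_const, probReal_univ, one_smul, one_pow,
    mul_one] at h1
  rw [integral_indicator_separated hc hc1 i A hiA, h1, mul_comm]

lemma ae_injective_pi (n : ℕ) :
    ∀ᵐ z ∂(Measure.pi fun _ : Fin n => expMeasure 1), Function.Injective z := by
  have key : ∀ i j : Fin n, i ≠ j →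
      ∀ᵐ z ∂(Measure.pi fun _ : Fin n => expMeasure 1), z i ≠ z j := by
    intro i j hij
    cases n with
    | zero => exact i.elim0
    | succ m =>
      obtain ⟨j', rfl⟩ := Fin.exists_succAbove_eq hij.symm
      let μ : Fin (m + 1) → Measure ℝ := fun _ => expMeasure 1
      have hmp := measurePreserving_piFinSuccAbove μ i
      have hms : MeasurableSet {q : ℝ × (Fin m → ℝ) | q.2 j' = q.1} :=
        measurableSet_eq_fun ((measurable_pi_apply j').comp measurable_snd) measurable_fst
      have h0 : ((expMeasure 1).prod (Measure.pi fun _ : Fin m => expMeasure 1))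
          {q : ℝ × (Fin m → ℝ) | q.2 j' = q.1} = 0 := by
        rw [Measure.measure_prod_null hms]
        exact ae_of_all _ fun x => Measure.pi_hyperplane (fun _ => expMeasure 1) j' x
      have h1 := hmp.measure_preimage hms.nullMeasurableSet
      rw [ae_iff]
      refine measure_mono_null (fun z hz => ?_) (h1.trans h0)
      exact (not_not.1 hz).symm
  have : ∀ᵐ z ∂(Measure.pi fun _ : Fin n => expMeasure 1), ∀ i j : Fin n, i ≠ j → z i ≠ z j :=
    ae_all_iff.2 fun i => ae_all_iff.2 fun j => by
      by_cases h : i = j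
      · exact ae_of_all _ fun z h' => absurd h h'
      · filter_upwards [key i j h] with z hz _ using hz
  filter_upwards [this] with z hz i j hij
  by_contra h
  exact hz i j h hij

variable {Ω : Type*} [MeasurableSpace Ω] {P : Measure Ω}
  {Y : ℕ → Ω → ℝ}

lemma integral_of_law (hY : ∀ i, Measurable (Y i)) (hlaw : ∀ i, P.map (Y i) = expMeasure 1)
    (i : ℕ) : ∫ ω, Y i ω ∂P = 1 := by
  have h := integral_pow_expMeasure 1
  rw [← hlaw i, integral_map (hY i).aemeasurable (by fun_prop)] at h
  simpa using h

lemma integrable_of_law (hY : ∀ i, Measurable (Y i)) (hlaw : ∀ i, P.map (Y i) = expMeasure 1)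
    (i : ℕ) : Integrable (Y i) P := by
  by_contra h
  exact zero_ne_one ((integral_undef h).symm.trans (integral_of_law hY hlaw i))

lemma memLp_of_law (hY : ∀ i, Measurable (Y i)) (hlaw : ∀ i, P.map (Y i) = expMeasure 1)
    (i : ℕ) : MemLp (Y i) 2 P := by
  have h := memLp_id_expMeasure
  rw [← hlaw i] at h
  exact h.comp_of_map (hY i).aemeasurable

lemma variance_of_law (hY : ∀ i, Measurable (Y i)) (hlaw : ∀ i, P.map (Y i) = expMeasure 1)
    (i : ℕ) : Var[Y i; P] = 1 := by
  have h := variance_id_expMeasure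
  rwa [← hlaw i, variance_map aemeasurable_id (hY i).aemeasurable] at h

variable [IsProbabilityMeasure P]

/-- Rényi's representation, for the sum of the normalised spacings: the total excess of an
exponential sample over its `k + 1`-st largest value is distributed as a sum of `k` independent
exponential variables. -/
lemma map_sum_max_eq (hY : ∀ i, Measurable (Y i)) (hlaw : ∀ i, P.map (Y i) = expMeasure 1)
    (hindep : iIndepFun Y P) {n k : ℕ} (hkn : k < n) :
    P.map (fun ω => ∑ i ∈ Finset.range n,
        max (Y i ω - orderStat (fun i => Y i ω) n (n - k)) 0) =
      P.map (fun ω => ∑ i ∈ Finset.range k, Y i ω) := by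
  have hexc : Measurable fun ω => ∑ i ∈ Finset.range n,
      max (Y i ω - orderStat (fun i => Y i ω) n (n - k)) 0 :=
    Finset.measurable_sum _ fun i _ =>
      ((hY i).sub (measurable_orderStat hY n _)).max measurable_const
  have hsum : Measurable fun ω => ∑ i ∈ Finset.range k, Y i ω :=
    Finset.measurable_sum _ fun i _ => hY i
  have := Measure.isProbabilityMeasure_map (μ := P) hexc.aemeasurable
  have := Measure.isProbabilityMeasure_map (μ := P) hsum.aemeasurable
  refine Measure.ext_of_charFun (funext fun t => ?_)
  rw [iIndepFun.charFun_map_fun_finsetSum_eq_prod (fun i _ => (hY i).aemeasurable)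
    (hindep.precomp (g := fun i : Finset.range k => (i : ℕ)) Subtype.val_injective)]
  simp only [Finset.prod_apply, hlaw, Finset.prod_const, Finset.card_range]
  set c : ℝ → ℂ := fun y => Complex.exp (t * y * Complex.I) with hc_def
  have hc : Measurable c := by fun_prop
  have hc1 : ∀ x, ‖c x‖ ≤ 1 := fun x => by
    rw [hc_def]
    simp only
    rw [← Complex.ofReal_mul, Complex.norm_exp_ofReal_mul_I]
  obtain ⟨m, rfl⟩ : ∃ m, n = m + 1 := ⟨n - 1, by omega⟩
  let Z : Ω → Fin (m + 1) → ℝ := fun ω i => Y i ω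
  have hZ : Measurable Z := measurable_pi_lambda _ fun i => hY i
  have hZlaw : P.map Z = Measure.pi fun _ : Fin (m + 1) => expMeasure 1 := by
    have h := iIndepFun.map_fun_eq_pi_map (fun i : Fin (m + 1) => (hY i).aemeasurable)
      (hindep.precomp Fin.val_injective)
    simpa only [hlaw] using h
  have hinj : ∀ᵐ ω ∂P, Function.Injective (Z ω) := by
    have h := ae_injective_pi (m + 1)
    rw [← hZlaw] at h
    exact ae_of_ae_map hZ.aemeasurable h
  have hmeas : ∀ p : Fin (m + 1) × Finset (Fin (m + 1)), Measurable
      ((separated p.1 p.2).indicator fun z => ∏ a ∈ p.2, c (z a - z p.1)) := fun p =>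
    (Finset.measurable_prod _ fun a _ =>
      hc.comp ((measurable_pi_apply a).sub (measurable_pi_apply p.1))).indicator
        (measurableSet_separated _ _)
  have hmeas1 : ∀ p : Fin (m + 1) × Finset (Fin (m + 1)), Measurable
      ((separated p.1 p.2).indicator fun _ => (1 : ℂ)) := fun p =>
    measurable_const.indicator (measurableSet_separated _ _)
  rw [charFun_apply_real, charFun_apply_real, integral_map hexc.aemeasurable
    hc.aestronglyMeasurable]
  calc ∫ ω, c (∑ i ∈ Finset.range (m + 1),
          max (Y i ω - orderStat (fun i => Y i ω) (m + 1) (m + 1 - k)) 0) ∂P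
      = ∫ ω, ∑ p ∈ thresholdPairs (m + 1) k,
          (separated p.1 p.2).indicator (fun z => ∏ a ∈ p.2, c (z a - z p.1)) (Z ω) ∂P := by
        refine integral_congr_ae ?_
        filter_upwards [hinj] with ω hω
        rw [← sum_indicator_separated (fun i => Y i ω) hkn hω (c _)]
        refine Finset.sum_congr rfl fun p hp => ?_
        by_cases hpZ : Z ω ∈ separated p.1 p.2
        · rw [indicator_of_mem hpZ]
          refine Eq.trans ?_ (indicator_of_mem (M := ℂ) hpZ _).symm
          rw [sum_max_of_separated (fun i => Y i ω) hp hpZ, hc_def]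
          simp only
          rw [← Complex.exp_sum]
          push_cast
          rw [Finset.mul_sum, Finset.sum_mul]
        · rw [indicator_of_notMem hpZ]
          exact (indicator_of_notMem (M := ℂ) hpZ _).symm
    _ = ∑ p ∈ thresholdPairs (m + 1) k, ∫ ω,
          (separated p.1 p.2).indicator (fun z => ∏ a ∈ p.2, c (z a - z p.1)) (Z ω) ∂P := by
        refine integral_finsetSum _ fun p _ => ?_
        refine Integrable.of_bound ((hmeas p).comp hZ).aestronglyMeasurable 1
          (ae_of_all _ fun ω => ?_)
        refine (norm_indicator_le_norm_self _ _).trans ?_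
        rw [norm_prod]
        exact Finset.prod_le_one (fun _ _ => norm_nonneg _) fun _ _ => hc1 _
    _ = ∑ p ∈ thresholdPairs (m + 1) k, (∫ y, c y ∂(expMeasure 1)) ^ k *
          ∫ ω, (separated p.1 p.2).indicator (fun _ => (1 : ℂ)) (Z ω) ∂P := by
        refine Finset.sum_congr rfl fun p hp => ?_
        simp only [thresholdPairs, Finset.mem_filter, Finset.mem_univ, true_and] at hp
        rw [← integral_map hZ.aemeasurable (hmeas p).aestronglyMeasurable,
          ← integral_map hZ.aemeasurable (hmeas1 p).aestronglyMeasurable, hZlaw,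
          integral_indicator_separated_eq hc hc1 _ _ hp.1, hp.2]
    _ = (∫ y, c y ∂(expMeasure 1)) ^ k * ∫ ω, ∑ p ∈ thresholdPairs (m + 1) k,
          (separated p.1 p.2).indicator (fun _ => (1 : ℂ)) (Z ω) ∂P := by
        rw [← Finset.mul_sum, integral_finsetSum]
        refine fun p _ => Integrable.of_bound ((hmeas1 p).comp hZ).aestronglyMeasurable 1
          (ae_of_all _ fun ω => ?_)
        exact (norm_indicator_le_norm_self _ _).trans (by simp)
    _ = (∫ y, c y ∂(expMeasure 1)) ^ k := by
        have h1 : ∫ ω, ∑ p ∈ thresholdPairs (m + 1) k,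
            (separated p.1 p.2).indicator (fun _ => (1 : ℂ)) (Z ω) ∂P = ∫ _, (1 : ℂ) ∂P := by
          refine integral_congr_ae ?_
          filter_upwards [hinj] with ω hω
          exact sum_indicator_separated (fun i => Y i ω) hkn hω 1
        rw [h1]
        simp

/-! ### The Hill estimator of an exponential sample -/

lemma tendstoInDistribution_hill_exp (hY : ∀ i, Measurable (Y i))
    (hlaw : ∀ i, P.map (Y i) = expMeasure 1) (hindep : iIndepFun Y P) {k : ℕ → ℕ}
    (hk : Tendsto k atTop atTop) (hkn : ∀ᶠ n in atTop, k n < n) (s : ℝ) :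
    TendstoInDistribution
      (fun (n : ℕ) (ω : Ω) =>
        s * (Real.sqrt (k n : ℝ) * (hill (fun i => Y i ω) n (k n) - 1)))
      atTop (id : ℝ → ℝ) (fun _ => P) (gaussianReal 0 (Real.toNNReal (s ^ 2))) := by
  have hvar : Var[fun ω => s * Y 0 ω; P] = s ^ 2 := by
    rw [variance_const_mul, variance_of_law hY hlaw 0, mul_one]
  have hmean : ∫ ω, s * Y 0 ω ∂P = s := by
    rw [integral_const_mul, integral_of_law hY hlaw 0, mul_one]
  have hmeas : ∀ n, Measurable fun ω =>
      s * (Real.sqrt (k n : ℝ) * (hill (fun i => Y i ω) n (k n) - 1)) := fun n =>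
    (((measurable_hill hY n (k n)).sub_const 1).const_mul _).const_mul _
  have hclt := tendstoInDistribution_inv_sqrt_mul_sum_sub (P := P)
    (P' := gaussianReal 0 (Real.toNNReal (s ^ 2))) (Y := id) (X := fun i ω => s * Y i ω)
    ⟨aemeasurable_id, by rw [Measure.map_id, hvar]⟩ ((memLp_of_law hY hlaw 0).const_mul s)
    (hindep.comp (fun _ y => s * y) fun _ => by fun_prop)
    (fun i => by
      have h : IdentDistrib (Y i) (Y 0) P P :=
        ⟨(hY i).aemeasurable, (hY 0).aemeasurable, by rw [hlaw, hlaw]⟩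
      exact h.comp (u := fun y => s * y) (by fun_prop))
  refine ⟨fun n => (hmeas n).aemeasurable, aemeasurable_id, ?_⟩
  refine (hclt.tendsto.comp hk).congr' ?_
  filter_upwards [hkn, hk.eventually_gt_atTop 0] with n hn hn0
  refine Subtype.ext ?_
  have hk0 : (0 : ℝ) < k n := by exact_mod_cast hn0
  let f : ℝ → ℝ := fun x => (Real.sqrt (k n))⁻¹ * (s * x - k n * s)
  have hf : Measurable f := by fun_prop
  have h1 : (fun ω => (Real.sqrt (k n))⁻¹ *
      (∑ i ∈ Finset.range (k n), s * Y i ω - k n * ∫ ω, s * Y 0 ω ∂P)) =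
        f ∘ fun ω => ∑ i ∈ Finset.range (k n), Y i ω := by
    ext ω
    simp only [f, Function.comp, hmean, Finset.mul_sum]
  have h2 : (fun ω => s * (Real.sqrt (k n : ℝ) * (hill (fun i => Y i ω) n (k n) - 1))) =
      f ∘ fun ω => ∑ i ∈ Finset.range n,
        max (Y i ω - orderStat (fun i => Y i ω) n (n - k n)) 0 := by
    ext ω
    simp only [f, Function.comp]
    rw [hill_eq_sum_max _ hn]
    have h3 : Real.sqrt (k n) ≠ 0 := (Real.sqrt_pos.2 hk0).ne'
    have h4 : Real.sqrt (k n) ^ 2 = k n := Real.sq_sqrt hk0.le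
    field_simp
    rw [h4]
  change P.map (fun ω => (Real.sqrt (k n))⁻¹ *
      (∑ i ∈ Finset.range (k n), s * Y i ω - k n * ∫ ω, s * Y 0 ω ∂P)) =
    P.map (fun ω => s * (Real.sqrt (k n : ℝ) * (hill (fun i => Y i ω) n (k n) - 1)))
  rw [h1, h2, ← Measure.map_map hf (Finset.measurable_sum _ fun i _ => hY i),
    ← map_sum_max_eq hY hlaw hindep hn, Measure.map_map hf]
  exact Finset.measurable_sum _ fun i _ =>
    ((hY i).sub (measurable_orderStat hY n _)).max measurable_const

lemma hill_nonneg (x : ℕ → ℝ) {n k : ℕ} (hkn : k < n) : 0 ≤ hill x n k := by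
  rw [hill_eq_sum_max x hkn]
  exact mul_nonneg (by positivity) (Finset.sum_nonneg fun i _ => le_max_right _ _)

lemma integral_hill_exp (hY : ∀ i, Measurable (Y i))
    (hlaw : ∀ i, P.map (Y i) = expMeasure 1) (hindep : iIndepFun Y P) {n k : ℕ}
    (hk : 0 < k) (hkn : k < n) : ∫ ω, hill (fun i => Y i ω) n k ∂P = 1 := by
  have hk0 : (k : ℝ) ≠ 0 := by positivity
  have hid : IdentDistrib (fun ω => ∑ i ∈ Finset.range n,
        max (Y i ω - orderStat (fun i => Y i ω) n (n - k)) 0)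
      (fun ω => ∑ i ∈ Finset.range k, Y i ω) P P :=
    ⟨(Finset.measurable_sum _ fun i _ =>
        ((hY i).sub (measurable_orderStat hY n _)).max measurable_const).aemeasurable,
      (Finset.measurable_sum _ fun i _ => hY i).aemeasurable, map_sum_max_eq hY hlaw hindep hkn⟩
  simp_rw [hill_eq_sum_max _ hkn]
  rw [integral_const_mul, hid.integral_eq,
    integral_finsetSum _ fun i _ => integrable_of_law hY hlaw i]
  simp [integral_of_law hY hlaw, hk0]

/-- Markov's inequality for the Hill estimator of an exponential sample. -/
lemma measureReal_le_hill_exp (hY : ∀ i, Measurable (Y i))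
    (hlaw : ∀ i, P.map (Y i) = expMeasure 1) (hindep : iIndepFun Y P) {n k : ℕ}
    (hk : 0 < k) (hkn : k < n) {r : ℝ} (hr : 0 < r) :
    P.real {ω | r ≤ hill (fun i => Y i ω) n k} ≤ 1 / r := by
  have h1 := integral_hill_exp hY hlaw hindep hk hkn
  have hint : Integrable (fun ω => hill (fun i => Y i ω) n k) P := by
    by_contra h
    exact zero_ne_one ((integral_undef h).symm.trans h1)
  have h2 := mul_meas_ge_le_integral_of_nonneg
    (ae_of_all _ fun ω => hill_nonneg (fun i => Y i ω) hkn) hint r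
  rw [h1] at h2
  rwa [le_div_iff₀' hr]

/-- Chebyshev's inequality for the number of observations below `u` shows that the threshold of an
exponential sample exceeds `u` with high probability if `k` is at most half of the mean number
`n * exp (-u)` of observations above `u`. -/
lemma measureReal_orderStat_le (hY : ∀ i, Measurable (Y i))
    (hlaw : ∀ i, P.map (Y i) = expMeasure 1) (hindep : iIndepFun Y P) {n k : ℕ} (hkn : k < n)
    {u : ℝ} (hu : 0 ≤ u) (hku : (k : ℝ) ≤ n * Real.exp (-u) / 2) :
    P.real {ω | orderStat (fun i => Y i ω) n (n - k) ≤ u} ≤ 4 / (n * Real.exp (-u)) := by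
  set p := Real.exp (-u)
  have hp : 0 < p := Real.exp_pos _
  have hn : (0 : ℝ) < n := by exact_mod_cast (Nat.zero_le k).trans_lt hkn
  let h : ℝ → ℝ := (Iic u).indicator 1
  have hh : Measurable h := measurable_one.indicator measurableSet_Iic
  have hh1 : ∀ x, ‖h x‖ ≤ 1 := fun x => (norm_indicator_le_norm_self _ _).trans (by simp)
  have hLp : ∀ i, MemLp (fun ω => h (Y i ω)) 2 P := fun i =>
    MemLp.of_bound (hh.comp (hY i)).aestronglyMeasurable 1 (ae_of_all _ fun ω => hh1 _)
  have hmean : ∀ i, ∫ ω, h (Y i ω) ∂P = 1 - p := fun i => by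
    rw [← integral_map (hY i).aemeasurable hh.aestronglyMeasurable, hlaw,
      integral_indicator_one measurableSet_Iic, ← cdf_eq_real, cdf_expMeasure_eq zero_lt_one,
      if_pos hu, one_mul]
  have hvar : ∀ i, Var[fun ω => h (Y i ω); P] ≤ p := fun i => by
    rw [variance_eq_sub (hLp i)]
    have hsq : (fun ω => h (Y i ω)) ^ 2 = fun ω => h (Y i ω) := by
      ext ω
      by_cases hω : Y i ω ≤ u <;> simp [h, indicator, hω]
    rw [hsq, hmean]
    nlinarith [sq_nonneg p]
  have hsum_mean : ∫ ω, (∑ i ∈ Finset.range n, fun ω => h (Y i ω)) ω ∂P = n * (1 - p) := by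
    simp only [Finset.sum_apply]
    rw [integral_finsetSum _ fun i _ => (hLp i).integrable (by norm_num)]
    simp only [hmean, Finset.sum_const, Finset.card_range, nsmul_eq_mul]
  have hsum_var : Var[∑ i ∈ Finset.range n, fun ω => h (Y i ω); P] ≤ n * p := by
    rw [IndepFun.variance_sum (fun i _ => hLp i) fun i _ j _ hij =>
      (hindep.indepFun hij).comp hh hh]
    calc _ ≤ ∑ i ∈ Finset.range n, p := Finset.sum_le_sum fun i _ => hvar i
      _ = n * p := by simp
  have hcheb := meas_ge_le_variance_div_sq
    (memLp_finsetSum' (Finset.range n) fun i _ => hLp i) (show 0 < n * p / 2 by positivity)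
  have hcheb' := ENNReal.toReal_mono ENNReal.ofReal_ne_top hcheb
  rw [ENNReal.toReal_ofReal (div_nonneg (variance_nonneg _ _) (sq_nonneg _))] at hcheb'
  refine (measureReal_mono (fun ω hω => ?_)).trans (hcheb'.trans ?_)
  · rw [mem_ofPred_eq, orderStat_le_iff _ (by omega) (by omega), Nat.cast_sub hkn.le] at hω
    rw [mem_ofPred_eq, hsum_mean, Finset.sum_apply]
    refine le_trans ?_ (le_abs_self _)
    change _ ≤ ∑ i ∈ Finset.range n, h (Y i ω) at hω
    linarith
  · rw [div_le_div_iff₀ (by positivity) (by positivity)]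
    have : 0 < n * p := by positivity
    nlinarith [mul_le_mul_of_nonneg_right hsum_var this.le]

/-! ### Comparison of the two Hill estimators -/

/-- Up to the factor `θ`, the Hill estimators of a sample and of its hazard transform differ by a
relative error of at most the reciprocal of the transformed threshold. -/
lemma abs_hill_sub_hill_le {θ β : ℝ} (hθ : 0 < θ) (hβ : 1 < β) (x : ℕ → ℝ) {n k : ℕ}
    (hkn : k < n) (hT : 0 < orderStat (fun i => cumHazard θ β (x i)) n (n - k)) :
    |θ * hill x n k - hill (fun i => cumHazard θ β (x i)) n k| ≤
      hill (fun i => cumHazard θ β (x i)) n k /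
        orderStat (fun i => cumHazard θ β (x i)) n (n - k) := by
  have hmono := (strictMono_cumHazard hθ hβ).monotone
  rw [hill_eq_sum_max _ hkn, hill_eq_sum_max _ hkn]
  rw [orderStat_comp hmono x (by omega) (by omega)] at hT ⊢
  set T := orderStat x n (n - k)
  have hterm : ∀ y, max (cumHazard θ β y - cumHazard θ β T) 0 ≤ θ * max (y - T) 0 ∧
      θ * max (y - T) 0 - max (cumHazard θ β y - cumHazard θ β T) 0 ≤
        max (cumHazard θ β y - cumHazard θ β T) 0 / cumHazard θ β T := by
    intro y
    rcases le_total T y with hy | hy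
    · rw [max_eq_left (sub_nonneg.2 (hmono hy)), max_eq_left (sub_nonneg.2 hy)]
      exact ⟨cumHazard_sub_le hθ hβ hy, mul_sub_sub_cumHazard_le hθ hβ hy hT⟩
    · rw [max_eq_right (sub_nonpos.2 (hmono hy)), max_eq_right (sub_nonpos.2 hy)]
      simp
  have h1 := Finset.sum_le_sum fun i (_ : i ∈ Finset.range n) => (hterm (x i)).1
  have h2 := Finset.sum_le_sum fun i (_ : i ∈ Finset.range n) => (hterm (x i)).2
  rw [← Finset.mul_sum] at h1
  rw [Finset.sum_sub_distrib, ← Finset.mul_sum, ← Finset.sum_div] at h2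
  have hk : 0 ≤ 1 / (k : ℝ) := by positivity
  rw [mul_left_comm, ← mul_sub, mul_div_assoc, abs_of_nonneg (mul_nonneg hk (sub_nonneg.2 h1))]
  exact mul_le_mul_of_nonneg_left h2 hk

/-! ### Growth of the number of upper order statistics -/

lemma tendsto_sqrt_div_log {k : ℕ → ℕ}
    (hK : Tendsto (fun n : ℕ => ((k n : ℝ) ^ (3 / 4 : ℝ)) / Real.log (n : ℝ)) atTop (𝓝 0)) :
    Tendsto (fun n : ℕ => Real.sqrt (k n) / Real.log n) atTop (𝓝 0) := by
  refine squeeze_zero (fun n => div_nonneg (Real.sqrt_nonneg _) (Real.log_natCast_nonneg n))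
    (fun n => ?_) hK
  refine div_le_div_of_nonneg_right ?_ (Real.log_natCast_nonneg n)
  rcases Nat.eq_zero_or_pos (k n) with h | h
  · rw [h]
    norm_num
  · rw [Real.sqrt_eq_rpow]
    exact Real.rpow_le_rpow_of_exponent_le (by exact_mod_cast h) (by norm_num)

lemma mul_exp_neg_half_log {n : ℕ} (hn : 0 < n) :
    n * Real.exp (-(Real.log n / 2)) = Real.sqrt n := by
  have hn' : (0 : ℝ) < n := by exact_mod_cast hn
  nth_rewrite 1 [← Real.exp_log hn']
  rw [← Real.exp_add, Real.sqrt_eq_rpow, Real.rpow_def_of_pos hn']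
  ring_nf

lemma eventually_le_sqrt_div_two {k : ℕ → ℕ}
    (hK : Tendsto (fun n : ℕ => ((k n : ℝ) ^ (3 / 4 : ℝ)) / Real.log (n : ℝ)) atTop (𝓝 0)) :
    ∀ᶠ n : ℕ in atTop, (k n : ℝ) ≤ Real.sqrt n / 2 := by
  have h1 := ((isLittleO_log_rpow_rpow_atTop (4 / 3)
    (show (0 : ℝ) < 1 / 2 by norm_num)).comp_tendsto tendsto_natCast_atTop_atTop).bound
    (show (0 : ℝ) < 1 / 2 by norm_num)
  filter_upwards [h1, hK.eventually_lt_const zero_lt_one, eventually_gt_atTop 1] with n hn1 hn2 hn3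
  have hlog : 0 < Real.log n := Real.log_pos (by exact_mod_cast hn3)
  rw [div_lt_one hlog] at hn2
  simp only [Function.comp] at hn1
  rw [Real.norm_of_nonneg (by positivity), Real.norm_of_nonneg (by positivity),
    ← Real.sqrt_eq_rpow] at hn1
  calc (k n : ℝ) = ((k n : ℝ) ^ (3 / 4 : ℝ)) ^ (4 / 3 : ℝ) := by
        rw [← Real.rpow_mul (by positivity)]
        norm_num
    _ ≤ Real.log n ^ (4 / 3 : ℝ) := by gcongr
    _ ≤ _ := by linarith

lemma eventually_lt_self {k : ℕ → ℕ}
    (hK : Tendsto (fun n : ℕ => ((k n : ℝ) ^ (3 / 4 : ℝ)) / Real.log (n : ℝ)) atTop (𝓝 0)) :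
    ∀ᶠ n : ℕ in atTop, k n < n := by
  filter_upwards [eventually_le_sqrt_div_two hK, eventually_gt_atTop 0] with n hn hn0
  have h1 : (1 : ℝ) ≤ n := by exact_mod_cast hn0
  have h2 : Real.sqrt n ≤ n := Real.sqrt_le_left (by positivity) |>.2 (by nlinarith)
  exact_mod_cast (show (k n : ℝ) < n by linarith)

/-! ### Asymptotic normality -/

/-- Up to the factor `θ`, the Hill estimator of the sample and that of its hazard transform are
asymptotically equivalent at scale `1 / √k`. The threshold of the transformed sample exceeds `log n / 2` with
high probability, and `√k / log n` tends to zero. -/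
lemma tendstoInMeasure_hill_sub_hill_exp {Ω : Type*} [MeasurableSpace Ω] {P : Measure Ω}
    [IsProbabilityMeasure P] {θ β : ℝ} (hθ : 0 < θ) (hβ : 1 < β) {X : ℕ → Ω → ℝ}
    (hX : ∀ i, Measurable (X i))
    (hlaw : ∀ i, P.map (fun ω => cumHazard θ β (X i ω)) = expMeasure 1)
    (hindep : iIndepFun (fun i ω => cumHazard θ β (X i ω)) P) {k : ℕ → ℕ}
    (hk_top : Tendsto k atTop atTop)
    (hK : Tendsto (fun n : ℕ => ((k n : ℝ) ^ (3 / 4 : ℝ)) / Real.log (n : ℝ)) atTop (𝓝 0)) :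
    TendstoInMeasure P
      (fun (n : ℕ) ω => Real.sqrt (k n) *
        (θ * hill (fun i => X i ω) n (k n) - hill (fun i => cumHazard θ β (X i ω)) n (k n)))
      atTop 0 := by
  have hY : ∀ i, Measurable fun ω => cumHazard θ β (X i ω) := fun i =>
    (continuous_cumHazard hβ).measurable.comp (hX i)
  rw [tendstoInMeasure_iff_measureReal_norm]
  intro ε hε
  have hlim : Tendsto (fun n : ℕ => 4 / Real.sqrt n + 2 / ε * (Real.sqrt (k n) / Real.log n))
      atTop (𝓝 (0 + 2 / ε * 0)) :=
    ((Real.tendsto_sqrt_atTop.comp tendsto_natCast_atTop_atTop).const_div_atTop 4).add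
      ((tendsto_sqrt_div_log hK).const_mul _)
  rw [mul_zero, add_zero] at hlim
  refine squeeze_zero' (Eventually.of_forall fun n => measureReal_nonneg) ?_ hlim
  filter_upwards [eventually_le_sqrt_div_two hK, eventually_lt_self hK, eventually_gt_atTop 1,
    hk_top.eventually_gt_atTop 0] with n hn1 hkn hn hk0
  have hlog : 0 < Real.log n := Real.log_pos (by exact_mod_cast hn)
  have hsk : 0 < Real.sqrt (k n) := Real.sqrt_pos.2 (by exact_mod_cast hk0)
  have hthr := measureReal_orderStat_le hY hlaw hindep hkn (u := Real.log n / 2) (by positivity)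
    (by rwa [mul_exp_neg_half_log (by omega)])
  rw [mul_exp_neg_half_log (by omega)] at hthr
  have hr : 0 < ε * (Real.log n / 2) / Real.sqrt (k n) := by positivity
  have hmarkov := measureReal_le_hill_exp hY hlaw hindep hk0 hkn hr
  have hr2 : 1 / (ε * (Real.log n / 2) / Real.sqrt (k n)) =
      2 / ε * (Real.sqrt (k n) / Real.log n) := by
    field_simp
  rw [hr2] at hmarkov
  refine (measureReal_mono (fun ω hω => ?_)).trans
    ((measureReal_union_le _ _).trans (add_le_add hthr hmarkov))
  rw [mem_union, mem_ofPred_eq, mem_ofPred_eq]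
  rw [mem_ofPred_eq, Pi.zero_apply, sub_zero, Real.norm_eq_abs, abs_mul, abs_of_pos hsk] at hω
  rcases le_or_gt (orderStat (fun i => cumHazard θ β (X i ω)) n (n - k n)) (Real.log n / 2)
    with hT | hT
  · exact Or.inl hT
  · right
    have h1 := abs_hill_sub_hill_le hθ hβ (fun i => X i ω) hkn (lt_trans (by positivity) hT)
    have h2 : hill (fun i => cumHazard θ β (X i ω)) n (k n) /
        orderStat (fun i => cumHazard θ β (X i ω)) n (n - k n) ≤
          hill (fun i => cumHazard θ β (X i ω)) n (k n) / (Real.log n / 2) :=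
      div_le_div_of_nonneg_left (hill_nonneg _ hkn) (by positivity) hT.le
    have h3 := hω.trans (mul_le_mul_of_nonneg_left (h1.trans h2) hsk.le)
    rw [← mul_div_assoc, le_div_iff₀ (by positivity)] at h3
    rw [div_le_iff₀ hsk]
    linarith

/-- The asymptotic normality under the additional assumption that the observations are
measurable, and not only almost everywhere equal to measurable functions. -/
lemma tendstoInDistribution_hill {Ω : Type*} [MeasurableSpace Ω] {P : Measure Ω}
    [IsProbabilityMeasure P] {θ β : ℝ} (hθ : 0 < θ) (hβ : 1 < β) {X : ℕ → Ω → ℝ}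
    (hX : ∀ i, Measurable (X i)) (hlaw : ∀ i, P.map (X i) = law θ β) (hindep : iIndepFun X P)
    {k : ℕ → ℕ} (hk_top : Tendsto k atTop atTop)
    (hK : Tendsto (fun n : ℕ => ((k n : ℝ) ^ (3 / 4 : ℝ)) / Real.log (n : ℝ)) atTop (𝓝 0)) :
    TendstoInDistribution
      (fun (n : ℕ) (ω : Ω) => Real.sqrt (k n : ℝ) * (hill (fun i => X i ω) n (k n) - 1 / θ))
      atTop (id : ℝ → ℝ) (fun _ => P) (gaussianReal 0 (Real.toNNReal ((1 / θ) ^ 2))) := by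
  have hg : Measurable (cumHazard θ β) := (continuous_cumHazard hβ).measurable
  have hlawY : ∀ i, P.map (fun ω => cumHazard θ β (X i ω)) = expMeasure 1 := fun i => by
    rw [← law_map_cumHazard hθ hβ, ← hlaw i, Measure.map_map hg (hX i)]
    rfl
  have hindepY : iIndepFun (fun i ω => cumHazard θ β (X i ω)) P :=
    hindep.comp (fun _ => cumHazard θ β) fun _ => hg
  refine tendstoInDistribution_of_tendstoInMeasure_sub _ _
    (tendstoInDistribution_hill_exp (fun i => hg.comp (hX i)) hlawY hindepY hk_top
      (eventually_lt_self hK) (1 / θ)) ?_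
    fun n => (((measurable_hill hX n (k n)).sub_const _).const_mul _).aemeasurable
  have h := tendstoInMeasure_hill_sub_hill_exp hθ hβ hX hlawY hindepY hk_top hK
  rw [tendstoInMeasure_iff_measureReal_norm] at h ⊢
  intro ε hε
  refine (h (θ * ε) (by positivity)).congr fun n => ?_
  congr 1
  ext ω
  simp only [mem_ofPred_eq, Pi.zero_apply, sub_zero, Pi.sub_apply]
  have key : ∀ r a b : ℝ, r * (θ * a - b) = θ * (r * (a - 1 / θ) - 1 / θ * (r * (b - 1))) := by
    intro r a b
    field_simp
    ring
  rw [key, norm_mul, Real.norm_of_nonneg hθ.le, mul_le_mul_iff_right₀ hθ]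
  rfl

end PseudoLindley

theorem theorem1
    {Ω : Type*} [MeasurableSpace Ω] (P : Measure Ω) [IsProbabilityMeasure P]
    (θ β : ℝ) (hθ : 0 < θ) (hβ : 1 < β)
    (X : ℕ → Ω → ℝ)
    (hlaw : ∀ i, HasLaw (X i) (PseudoLindley.law θ β) P)
    (hindep : iIndepFun X P)
    (k : ℕ → ℕ)
    (hk : ∀ n, 1 ≤ n → 0 < k n ∧ k n ≤ n)
    (hk_top : Tendsto k atTop atTop)
    (hK1 : Tendsto (fun n : ℕ => ((k n : ℝ) ^ (3 / 4 : ℝ)) / Real.log (n : ℝ)) atTop (𝓝 0)) :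
    TendstoInDistribution
      (fun (n : ℕ) (ω : Ω) =>
        Real.sqrt (k n : ℝ) * (PseudoLindley.hill (fun i => X i ω) n (k n) - 1 / θ))
      atTop
      (id : ℝ → ℝ)
      (fun _ => P)
      (gaussianReal 0 (Real.toNNReal ((1 / θ) ^ 2))) := by
  let X' : ℕ → Ω → ℝ := fun i => (hlaw i).aemeasurable.mk (X i)
  have hX' : ∀ i, Measurable (X' i) := fun i => (hlaw i).aemeasurable.measurable_mk
  have hae : ∀ i, X i =ᵐ[P] X' i := fun i => (hlaw i).aemeasurable.ae_eq_mk
  have hlaw' : ∀ i, P.map (X' i) = PseudoLindley.law θ β := fun i => by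
    rw [← Measure.map_congr (hae i), (hlaw i).map_eq]
  refine (PseudoLindley.tendstoInDistribution_hill hθ hβ hX' hlaw' (hindep.congr hae)
    hk_top hK1).congr (fun n => ?_) ae_eq_rfl
  filter_upwards [ae_all_iff.2 hae] with ω hω
  have : (fun i => X' i ω) = fun i => X i ω := funext fun i => (hω i).symm
  simp only [this]
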